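/- Let $\mathbb{D}=\{z\in\mathbb{C}:|z|<1\}$ and $\mathbb{T}=\partial\mathbb{D}$. A \emph{majorant} is a continuous nondecreasing function $\omega:[0,\infty)\to[0,\infty)$, not identically zero, with $\omega(0)=0$ and such that $\omega(t)/t$ is non-increasing on $(0,\infty)$. For $\Omega\subset\mathbb{C}$, let $\mathscr{L}_\omega(\Omega)$ be the set of functions $u:\Omega\to\mathbb{C}$ for which there is a constant $M>0$ with $|u(z_1)-u(z_2)|\le M\,\omega(|z_1-z_2|)$ for all $z_1,z_2\in\Omega$. Let $\omega$ be a majorant, let $g\in C(\overline{\mathbb{D}})$ and $\varphi\in\mathscr{L}_\omega(\mathbb{T})$ be complex-valued, and let $f:\mathbb{D}\to\mathbb{C}$ be four times continuously differentiable (in the real sense) and satisfy $$\Delta(\Delta f)=g \ \text{ in } \mathbb{D},\qquad \partial_{\overline z}f=\varphi \ \text{ on } \mathbb{T},\qquad f=0\ \text{ on } \mathbb{T},$$ where $\Delta=\partial_x^2+\partial_y^2$, $\partial_{\overline z}=\frac12(\partial_x+i\,\partial_y)$, and the boundary conditions mean that, for every $\zeta\in\mathbb{T}$, $\partial_{\overline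 z}f(z)\to\varphi(\zeta)$ and $f(z)\to 0$ as $z\to\zeta$, $z\in\mathbb{D}$. Then $f\in\mathscr{L}_\omega(\mathbb{D})$. -/

import Mathlib

open Metric Set Filter Topology

/-- A majorant: a continuous nondecreasing function `ω : [0, ∞) → [0, ∞)` with `ω 0 = 0`, not
identically zero, such that `ω t / t` is non-increasing on `(0, ∞)`. Only the values on `[0, ∞)`
matter. Given the other conditions, positivity on `(0, ∞)` says that `ω` is not identically zero
there. Strictly increasing functions are included. -/
structure IsMajorant (ω : ℝ → ℝ) : Prop where
  continuousOn : ContinuousOn ω (Ici 0)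
  monotoneOn : MonotoneOn ω (Ici 0)
  map_zero : ω 0 = 0
  pos : ∀ t, 0 < t → 0 < ω t
  antitoneOn_div : AntitoneOn (fun t => ω t / t) (Ioi 0)

/-- Membership of (the restriction to `Ω` of) `f` in the Lipschitz space `𝓛_ω(Ω)`. -/
def MemLipschitzSpace (ω : ℝ → ℝ) (Ω : Set ℂ) (f : ℂ → ℂ) : Prop :=
  ∃ M : ℝ, 0 < M ∧ ∀ z₁ ∈ Ω, ∀ z₂ ∈ Ω, ‖f z₁ - f z₂‖ ≤ M * ω ‖z₁ - z₂‖

/-- The operator `∂/∂z̄ = (1/2) (∂/∂x + i ∂/∂y)`, from the real Fréchet derivative. -/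
noncomputable def dzbar (f : ℂ → ℂ) (z : ℂ) : ℂ :=
  (1 / 2 : ℂ) * (fderiv ℝ f z 1 + Complex.I * fderiv ℝ f z Complex.I)

/-- The function `u` on the open unit disk has boundary values `φ` on the unit circle, i.e.
`u z → φ ζ` as `z → ζ` within the disk, for every `ζ` in the unit circle. -/
def HasBoundaryValues (u φ : ℂ → ℂ) : Prop :=
  ∀ ζ ∈ sphere (0 : ℂ) 1, Tendsto u (𝓝[ball (0 : ℂ) 1] ζ) (𝓝 (φ ζ))

/-! In fact `f` is Lipschitz on the disk, and on a bounded set Lipschitz functions lie in every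
`𝓛_ω`, because `ω t / t` is non-increasing. So it suffices to bound both Wirtinger derivatives.

The function `dzbar f` is bounded because it is continuous with boundary values everywhere on the
circle. Since `f` vanishes on the circle, a bound on `dzbar f` forces linear decay there
(`norm_le_of_dzbar_le`): at the centre this comes from integrating the radial derivative of circle
averages, and a Möbius map carries it to any other point.

For `dz f`, repeated integration of radial derivatives expands the average of `conj (z - c) * f z`
as `dz f c * r ^ 2 + b / 2 * r ^ 4 + O(r ^ 5)`, with remainder controlled by the bilaplacian. Two
radii eliminate `b` (`norm_dz_center_le`). At scale `1 - ‖c‖`, the decay of `f` cancels the division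
by the radius, so `dz f` is bounded. -/

open Real (circleAverage)

/-! ### Wirtinger derivatives. -/

/-- The operator `∂/∂z = (1/2) (∂/∂x - i ∂/∂y)`, from the real Fréchet derivative. -/
noncomputable def dz (f : ℂ → ℂ) (z : ℂ) : ℂ :=
  (1 / 2 : ℂ) * (fderiv ℝ f z 1 - Complex.I * fderiv ℝ f z Complex.I)

theorem clm_apply_eq (L : ℂ →L[ℝ] ℂ) (v : ℂ) :
    L v = (1 / 2 : ℂ) * (L 1 - Complex.I * L Complex.I) * v
      + (1 / 2 : ℂ) * (L 1 + Complex.I * L Complex.I) * (starRingEnd ℂ) v := by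
  have h : L v = v.re * L 1 + v.im * L Complex.I := by
    conv_lhs => rw [show v = v.re • (1 : ℂ) + v.im • Complex.I by simp]
    rw [map_add, map_smul, map_smul]
    simp
  rw [h]
  conv_rhs => rw [← Complex.re_add_im v]
  simp only [map_add, map_mul, Complex.conj_ofReal, Complex.conj_I]
  linear_combination (v.im * L Complex.I) * Complex.I_sq

theorem fderiv_apply_eq (f : ℂ → ℂ) (z v : ℂ) :
    fderiv ℝ f z v = dz f z * v + dzbar f z * (starRingEnd ℂ) v :=
  clm_apply_eq _ v

theorem HasFDerivAt.dzbar_eq {f : ℂ → ℂ} {L : ℂ →L[ℝ] ℂ} {z α β : ℂ} (h : HasFDerivAt f L z)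
    (hL : ∀ v, L v = α * v + β * (starRingEnd ℂ) v) : dzbar f z = β := by
  rw [dzbar, h.fderiv, hL, hL]
  simp only [map_one, Complex.conj_I]
  linear_combination (1 / 2 * α - 1 / 2 * β) * Complex.I_sq

theorem HasFDerivAt.dz_eq {f : ℂ → ℂ} {L : ℂ →L[ℝ] ℂ} {z α β : ℂ} (h : HasFDerivAt f L z)
    (hL : ∀ v, L v = α * v + β * (starRingEnd ℂ) v) : dz f z = α := by
  rw [dz, h.fderiv, hL, hL]
  simp only [map_one, Complex.conj_I]
  linear_combination (-1 / 2 * α + 1 / 2 * β) * Complex.I_sq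

theorem norm_fderiv_le (f : ℂ → ℂ) (z : ℂ) : ‖fderiv ℝ f z‖ ≤ ‖dz f z‖ + ‖dzbar f z‖ := by
  refine ContinuousLinearMap.opNorm_le_bound _ (by positivity) fun v => ?_
  rw [fderiv_apply_eq, add_mul]
  refine (norm_add_le _ _).trans ?_
  simp

theorem ContDiffOn.dz {f : ℂ → ℂ} {s : Set ℂ} {m n : WithTop ℕ∞} (hf : ContDiffOn ℝ n f s)
    (hs : IsOpen s) (hmn : m + 1 ≤ n) : ContDiffOn ℝ m (dz f) s := by
  have h := hf.fderiv_of_isOpen hs hmn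
  exact contDiffOn_const.mul ((h.clm_apply contDiffOn_const).sub
    (contDiffOn_const.mul (h.clm_apply contDiffOn_const)))

theorem ContDiffOn.dzbar {f : ℂ → ℂ} {s : Set ℂ} {m n : WithTop ℕ∞} (hf : ContDiffOn ℝ n f s)
    (hs : IsOpen s) (hmn : m + 1 ≤ n) : ContDiffOn ℝ m (dzbar f) s := by
  have h := hf.fderiv_of_isOpen hs hmn
  exact contDiffOn_const.mul ((h.clm_apply contDiffOn_const).add
    (contDiffOn_const.mul (h.clm_apply contDiffOn_const)))

theorem dzbar_dz_eq {f : ℂ → ℂ} {s : Set ℂ} (hf : ContDiffOn ℝ 2 f s) (hs : IsOpen s) {z : ℂ}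
    (hz : z ∈ s) : dzbar (dz f) z = (1 / 4 : ℂ) * Laplacian.laplacian f z := by
  have hfz : ContDiffAt ℝ 2 f z := hf.contDiffAt (hs.mem_nhds hz)
  have hd : DifferentiableAt ℝ (fderiv ℝ f) z :=
    (hfz.fderiv_right (m := 1) (by norm_num)).differentiableAt (by norm_num)
  have hsym : fderiv ℝ (fderiv ℝ f) z 1 Complex.I = fderiv ℝ (fderiv ℝ f) z Complex.I 1 :=
    (hfz.isSymmSndFDerivAt (by simp)).eq 1 Complex.I
  have h1 (v : ℂ) : HasFDerivAt (fun w => fderiv ℝ f w v) ((fderiv ℝ (fderiv ℝ f) z).flip v) z := by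
    simpa using hd.hasFDerivAt.clm_apply (hasFDerivAt_const v z)
  have h2 : HasFDerivAt (dz f) _ z := ((h1 1).sub ((h1 Complex.I).const_mul Complex.I)).const_mul
    (1 / 2 : ℂ)
  rw [dzbar, h2.fderiv, InnerProductSpace.laplacian_eq_iteratedFDeriv_complexPlane]
  simp only [iteratedFDeriv_two_apply, Matrix.cons_val_zero, Matrix.cons_val_one]
  simp [hsym]
  linear_combination (-1/4 * fderiv ℝ (fderiv ℝ f) z Complex.I Complex.I) * Complex.I_sq

/-! ### Radial derivatives of circle averages. -/

theorem norm_circleAverage_le {f : ℂ → ℂ} {c : ℂ} {r C : ℝ}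
    (h : ∀ z ∈ sphere c |r|, ‖f z‖ ≤ C) : ‖circleAverage f c r‖ ≤ C := by
  have h1 : ‖∫ θ in 0..2 * Real.pi, f (circleMap c r θ)‖ ≤ C * |2 * Real.pi - 0| :=
    intervalIntegral.norm_integral_le_of_norm_le_const
      fun θ _ => h _ (circleMap_mem_sphere' c r θ)
  have hp := Real.two_pi_pos
  rw [Real.circleAverage_def, norm_smul, Real.norm_eq_abs, abs_of_pos (inv_pos.2 hp)]
  rw [sub_zero, abs_of_pos hp] at h1
  rw [inv_mul_le_iff₀ hp]
  linarith

theorem hasDerivAt_circleAverage {f : ℂ → ℂ} {c : ℂ} {R r : ℝ} (hf : ContDiffOn ℝ 1 f (ball c R))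
    (hr : 0 < r) (hrR : r < R) :
    HasDerivAt (circleAverage f c)
      (circleAverage (fun z => fderiv ℝ f z ((z - c) / r)) c r) r := by
  -- The intermediate radius gives a compact disk on which `fderiv ℝ f` is bounded, hence a constant
  -- dominating function.
  obtain ⟨r', hr', hr'R⟩ := exists_between hrR
  have hfd : ContinuousOn (fderiv ℝ f) (ball c R) :=
    (hf.fderiv_of_isOpen (m := 0) isOpen_ball (by norm_num)).continuousOn
  obtain ⟨K, hK⟩ := (isCompact_closedBall c r').exists_bound_of_continuousOn
    (hfd.mono (closedBall_subset_ball hr'R))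
  have hmem (x : ℝ) (hx : x ∈ Ioo 0 r') (θ : ℝ) : circleMap c x θ ∈ closedBall c r' := by
    rw [mem_closedBall, dist_eq_norm, circleMap_sub_center, norm_circleMap_zero,
      abs_of_pos hx.1]
    exact hx.2.le
  have hmem' (x : ℝ) (hx : x ∈ Ioo 0 r') (θ : ℝ) : circleMap c x θ ∈ ball c R :=
    closedBall_subset_ball hr'R (hmem x hx θ)
  have hs : Ioo 0 r' ∈ 𝓝 r := Ioo_mem_nhds hr hr'
  have hc (x : ℝ) (hx : x ∈ Ioo 0 r') : Continuous fun θ => f (circleMap c x θ) :=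
    hf.continuousOn.comp_continuous (continuous_circleMap c x) (hmem' x hx)
  have hc' : Continuous fun θ => fderiv ℝ f (circleMap c r θ) (circleMap 0 1 θ) :=
    (hfd.comp_continuous (continuous_circleMap c r) (hmem' r ⟨hr, hr'⟩)).clm_apply
      (continuous_circleMap 0 1)
  have key := intervalIntegral.hasDerivAt_integral_of_dominated_loc_of_deriv_le (a := 0)
    (b := 2 * Real.pi) (μ := MeasureTheory.volume) (bound := fun _ => K)
    (F := fun x θ => f (circleMap c x θ))
    (F' := fun x θ => fderiv ℝ f (circleMap c x θ) (circleMap 0 1 θ)) hs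
    (by filter_upwards [hs] with x hx using (hc x hx).aestronglyMeasurable)
    ((hc r ⟨hr, hr'⟩).intervalIntegrable _ _) hc'.aestronglyMeasurable
    (.of_forall fun θ _ x hx => by
      refine (ContinuousLinearMap.le_opNorm _ _).trans ?_
      rw [norm_circleMap_zero, abs_one, mul_one]
      exact hK _ (hmem x hx θ))
    intervalIntegrable_const
    (.of_forall fun θ _ x hx => by
      have h1 : HasFDerivAt f (fderiv ℝ f (circleMap c x θ)) (circleMap c x θ) :=
        ((hf.contDiffAt (isOpen_ball.mem_nhds (hmem' x hx θ))).differentiableAt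
          (by norm_num)).hasFDerivAt
      have h2 : HasDerivAt (fun x : ℝ => circleMap c x θ) (circleMap 0 1 θ) x := by
        have := ((Complex.ofRealCLM.hasDerivAt (x := x)).mul_const
          (Complex.exp (θ * Complex.I))).const_add c
        simpa [circleMap] using this
      exact h1.comp_hasDerivAt x h2)
  have e : circleAverage (fun z => fderiv ℝ f z ((z - c) / r)) c r =
      (2 * Real.pi)⁻¹ • ∫ θ in 0..2 * Real.pi,
        fderiv ℝ f (circleMap c r θ) (circleMap 0 1 θ) := by
    simp only [Real.circleAverage_def, circleMap_sub_center]
    simp [circleMap, hr.ne']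
  rw [e]
  exact key.2.const_smul (2 * Real.pi)⁻¹

/-- The integrand is the angular derivative of a periodic function. -/
theorem circleAverage_fderiv_I {f : ℂ → ℂ} {c : ℂ} {R r : ℝ} (hf : ContDiffOn ℝ 1 f (ball c R))
    (hr : 0 < r) (hrR : r < R) :
    circleAverage (fun z => fderiv ℝ f z ((z - c) * Complex.I)) c r = 0 := by
  have hmem (θ : ℝ) : circleMap c r θ ∈ ball c R := by
    rw [mem_ball, dist_eq_norm, circleMap_sub_center, norm_circleMap_zero, abs_of_pos hr]
    exact hrR
  have hfd : ContinuousOn (fderiv ℝ f) (ball c R) :=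
    (hf.fderiv_of_isOpen (m := 0) isOpen_ball (by norm_num)).continuousOn
  have hc' : Continuous fun θ => fderiv ℝ f (circleMap c r θ) (circleMap 0 r θ * Complex.I) :=
    (hfd.comp_continuous (continuous_circleMap c r) hmem).clm_apply
      ((continuous_circleMap 0 r).mul continuous_const)
  have h := intervalIntegral.integral_eq_sub_of_hasDerivAt (a := 0) (b := 2 * Real.pi)
    (f := fun θ => f (circleMap c r θ))
    (f' := fun θ => fderiv ℝ f (circleMap c r θ) (circleMap 0 r θ * Complex.I))
    (fun θ _ => ((hf.contDiffAt (isOpen_ball.mem_nhds (hmem θ))).differentiableAt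
          (by norm_num)).hasFDerivAt.comp_hasDerivAt θ (hasDerivAt_circleMap c r θ))
    (hc'.intervalIntegrable _ _)
  rw [Real.circleAverage_def]
  simp only [circleMap_sub_center]
  rw [h]
  simp [circleMap]

/-- The radial derivative is the sum of the `dz` and `dzbar` averages divided by `r`. The vanishing
mean of the angular derivative makes these averages equal, so each accounts for half. -/
theorem circleAverage_dz_dzbar {f : ℂ → ℂ} {c : ℂ} {R r : ℝ} (hf : ContDiffOn ℝ 1 f (ball c R))
    (hr : 0 < r) (hrR : r < R) :
    HasDerivAt (circleAverage f c)
        (2 / r * circleAverage (fun z => dzbar f z * (starRingEnd ℂ) (z - c)) c r) r ∧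
      HasDerivAt (circleAverage f c)
        (2 / r * circleAverage (fun z => dz f z * (z - c)) c r) r := by
  have hsub : sphere c r ⊆ ball c R := sphere_subset_ball hrR
  have hcz : ContinuousOn (fun z => dz f z * (z - c)) (sphere c r) :=
    ((hf.dz (m := 0) isOpen_ball (by norm_num)).continuousOn.mono hsub).mul (by fun_prop)
  have hcb : ContinuousOn (fun z => dzbar f z * (starRingEnd ℂ) (z - c)) (sphere c r) :=
    ((hf.dzbar (m := 0) isOpen_ball (by norm_num)).continuousOn.mono hsub).mul
      (Complex.continuous_conj.comp_continuousOn (by fun_prop))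
  have hiz := hcz.circleIntegrable hr.le
  have hib := hcb.circleIntegrable hr.le
  have h0 := circleAverage_fderiv_I hf hr hrR
  have h1 := hasDerivAt_circleAverage hf hr hrR
  have e0 : (fun z => fderiv ℝ f z ((z - c) * Complex.I)) = fun z => Complex.I •
      ((fun z => dz f z * (z - c)) - fun z => dzbar f z * (starRingEnd ℂ) (z - c)) z := by
    ext z
    rw [fderiv_apply_eq]
    simp
    ring
  have e1 : (fun z => fderiv ℝ f z ((z - c) / r)) = fun z => (1 / r : ℂ) •
      ((fun z => dz f z * (z - c)) + fun z => dzbar f z * (starRingEnd ℂ) (z - c)) z := by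
    ext z
    rw [fderiv_apply_eq]
    simp
    ring
  rw [e0, Real.circleAverage_fun_smul, Real.circleAverage_sub hiz hib] at h0
  rw [e1, Real.circleAverage_fun_smul, Real.circleAverage_add hiz hib] at h1
  have h2 := sub_eq_zero.1 ((smul_eq_zero.1 h0).resolve_left Complex.I_ne_zero)
  constructor
  · convert h1 using 1
    rw [h2, smul_eq_mul]; ring
  · convert h1 using 1
    rw [← h2, smul_eq_mul]; ring

/-- The radial formulas hold only for positive radii, so the mean value inequality is applied on
`[ε, r]` and `ε → 0`. -/
theorem norm_image_sub_le_of_Ioo {E : ℝ → ℂ} {E' : ℝ → ℂ} {r C : ℝ} (hr : 0 < r)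
    (hE : ContinuousOn E (Icc 0 r)) (hd : ∀ x ∈ Ioo 0 r, HasDerivAt E (E' x) x)
    (hC : ∀ x ∈ Ioo 0 r, ‖E' x‖ ≤ C) : ‖E r - E 0‖ ≤ C * r := by
  have h1 : ∀ ε ∈ Ioo 0 r, ‖E r - E ε‖ ≤ C * (r - ε) := fun ε hε =>
    norm_image_sub_le_of_norm_deriv_right_le_segment
      (hE.mono (Icc_subset_Icc_left hε.1.le))
      (fun x hx => (hd x ⟨hε.1.trans_le hx.1, hx.2⟩).hasDerivWithinAt)
      (fun x hx => hC x ⟨hε.1.trans_le hx.1, hx.2⟩) r ⟨hε.2.le, le_rfl⟩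
  have h0 : Tendsto E (𝓝[>] 0) (𝓝 (E 0)) :=
    ((hE 0 ⟨le_rfl, hr.le⟩).mono_of_mem_nhdsWithin (Icc_mem_nhdsGT hr)).tendsto
  have hid : Tendsto (fun ε : ℝ => C * (r - ε)) (𝓝[>] 0) (𝓝 (C * (r - 0))) :=
    ((continuous_const.mul (continuous_const.sub continuous_id)).tendsto 0).mono_left
      nhdsWithin_le_nhds
  have := le_of_tendsto_of_tendsto (tendsto_const_nhds.sub h0).norm hid
    (by filter_upwards [Ioo_mem_nhdsGT hr] with ε hε using h1 ε hε)
  simpa using this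

/-! ### Expansion of circle averages and the interior estimate. -/

theorem continuousOn_circleAverage {u : ℂ → ℂ} {c : ℂ} {R r : ℝ}
    (hu : ContinuousOn u (ball c R)) (hrR : r < R) :
    ContinuousOn (circleAverage u c) (Icc 0 r) := by
  refine Real.ContinuousOn.circleAverage (hu.mono fun z hz => ?_) fun x hx => hx.1
  rw [mem_ball, dist_eq_norm]
  exact hz.2.trans_lt hrR

theorem contDiffOn_conj_sub_mul {u : ℂ → ℂ} {c : ℂ} {s : Set ℂ} {n : WithTop ℕ∞}
    (hu : ContDiffOn ℝ n u s) :
    ContDiffOn ℝ n (fun z => (starRingEnd ℂ) (z - c) * u z) s :=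
  (Complex.conjCLE.contDiff.comp (contDiff_id.sub contDiff_const)).contDiffOn.mul hu

theorem dz_conj_sub_mul {u : ℂ → ℂ} {c z : ℂ} (hu : DifferentiableAt ℝ u z) :
    dz (fun w => (starRingEnd ℂ) (w - c) * u w) z = (starRingEnd ℂ) (z - c) * dz u z := by
  have h1 : HasFDerivAt (fun w : ℂ => (starRingEnd ℂ) (w - c))
      (Complex.conjCLE : ℂ →L[ℝ] ℂ) z := by
    have := (Complex.conjCLE : ℂ →L[ℝ] ℂ).hasFDerivAt.comp z
      ((hasFDerivAt_id (𝕜 := ℝ) z).sub_const c)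
    rw [ContinuousLinearMap.comp_id] at this
    exact this
  refine (h1.mul hu.hasFDerivAt).dz_eq (β := (starRingEnd ℂ) (z - c) * dzbar u z + u z)
    fun v => ?_
  simp only [add_apply, smul_apply, fderiv_apply_eq]
  simp
  ring

/-- The conjugate weight is invisible to `dz`, and `conj (z - c) * (z - c)` equals the constant `r ^
2` on the circle. -/
theorem hasDerivAt_circleAverage_conj_mul {u : ℂ → ℂ} {c : ℂ} {R r : ℝ}
    (hu : ContDiffOn ℝ 1 u (ball c R)) (hr : 0 < r) (hrR : r < R) :
    HasDerivAt (circleAverage (fun z => (starRingEnd ℂ) (z - c) * u z) c)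
      (2 * r * circleAverage (dz u) c r) r := by
  convert! (circleAverage_dz_dzbar (contDiffOn_conj_sub_mul (c := c) hu) hr hrR).2 using 1
  have e : EqOn (fun z => dz (fun w => (starRingEnd ℂ) (w - c) * u w) z * (z - c))
      (fun z => ((r : ℂ) ^ 2) • dz u z) (sphere c |r|) := by
    intro z hz
    rw [abs_of_pos hr] at hz
    have hzb : z ∈ ball c R := sphere_subset_ball hrR hz
    have hn : (starRingEnd ℂ) (z - c) * (z - c) = (r : ℂ) ^ 2 := by
      rw [Complex.conj_mul', ← dist_eq_norm, mem_sphere.1 hz]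
    simp only
    rw [dz_conj_sub_mul ((hu.contDiffAt (isOpen_ball.mem_nhds hzb)).differentiableAt
      (by norm_num)), smul_eq_mul, ← hn]
    ring
  rw [Real.circleAverage_congr_sphere e, Real.circleAverage_fun_smul, smul_eq_mul]
  have : (r : ℂ) ≠ 0 := by exact_mod_cast hr.ne'
  field_simp

theorem hasDerivAt_ofReal_pow (n : ℕ) (x : ℝ) :
    HasDerivAt (fun x : ℝ => (x : ℂ) ^ n) (n * (x : ℂ) ^ (n - 1)) x := by
  simpa using (hasDerivAt_pow n (x : ℂ)).comp_ofReal

/-- This and `norm_circleAverage_conj_mul_sub_le_of_dz` alternate to undo `dzbar` and `dz` one at a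
time. The remainder is integrated crudely, bounding powers of `x` by powers of `r`, so each use
doubles the constant. -/
theorem norm_circleAverage_sub_le_of_dzbar {u : ℂ → ℂ} {b c : ℂ} {R C : ℝ} {m : ℕ}
    (hu : ContDiffOn ℝ 1 u (ball c R)) (hC : 0 ≤ C)
    (h : ∀ r ∈ Ioo 0 R, ‖circleAverage (fun z => (starRingEnd ℂ) (z - c) * dzbar u z) c r
      - b * r ^ 2‖ ≤ C * r ^ (m + 1)) :
    ∀ r ∈ Ioo 0 R, ‖circleAverage u c r - u c - b * r ^ 2‖ ≤ 2 * C * r ^ (m + 1) := by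
  intro r hr
  have hcont : ContinuousOn (fun x : ℝ => circleAverage u c x - b * (x : ℂ) ^ 2) (Icc 0 r) :=
    (continuousOn_circleAverage hu.continuousOn hr.2).sub (by fun_prop)
  have key := norm_image_sub_le_of_Ioo (C := 2 * C * r ^ m) hr.1 hcont
    (fun x hx => (circleAverage_dz_dzbar hu hx.1 (hx.2.trans hr.2)).1.sub
      ((hasDerivAt_ofReal_pow 2 x).const_mul b)) fun x hx => ?_
  · simp only [Real.circleAverage_zero, Complex.ofReal_zero] at key
    convert! key using 1
    · congr 1; ring
    · ring
  · have hx0 : (x : ℂ) ≠ 0 := by exact_mod_cast hx.1.ne'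
    have h1 := h x ⟨hx.1, hx.2.trans hr.2⟩
    simp only [mul_comm ((starRingEnd ℂ) _)] at h1
    have e : 2 / (x : ℂ) * circleAverage (fun z => dzbar u z * (starRingEnd ℂ) (z - c)) c x
          - b * ((2 : ℕ) * (x : ℂ) ^ (2 - 1)) = 2 / (x : ℂ) *
        (circleAverage (fun z => dzbar u z * (starRingEnd ℂ) (z - c)) c x - b * x ^ 2) := by
      field_simp
      push_cast
      ring
    rw [e, norm_mul, norm_div, Complex.norm_real, Real.norm_of_nonneg hx.1.le]
    calc _ ≤ ‖(2 : ℂ)‖ / x * (C * x ^ (m + 1)) := by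
          gcongr
          exact div_nonneg (norm_nonneg _) hx.1.le
      _ = 2 * C * x ^ m := by
          have := hx.1.ne'
          simp
          field_simp
          ring
      _ ≤ _ := by
          gcongr
          · exact hx.1.le
          · exact hx.2.le

theorem norm_circleAverage_conj_mul_sub_le_of_dz {u : ℂ → ℂ} {a b c : ℂ} {R C : ℝ} {m : ℕ}
    (hu : ContDiffOn ℝ 1 u (ball c R)) (hC : 0 ≤ C)
    (h : ∀ r ∈ Ioo 0 R, ‖circleAverage (dz u) c r - a - b * r ^ 2‖ ≤ C * r ^ m) :
    ∀ r ∈ Ioo 0 R, ‖circleAverage (fun z => (starRingEnd ℂ) (z - c) * u z) c r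
      - a * r ^ 2 - b / 2 * r ^ 4‖ ≤ 2 * C * r ^ (m + 2) := by
  intro r hr
  have hcont : ContinuousOn (fun x : ℝ =>
      circleAverage (fun z => (starRingEnd ℂ) (z - c) * u z) c x - a * (x : ℂ) ^ 2
        - b / 2 * (x : ℂ) ^ 4) (Icc 0 r) :=
    ((continuousOn_circleAverage (contDiffOn_conj_sub_mul hu).continuousOn hr.2).sub
      (by fun_prop)).sub (by fun_prop)
  have key := norm_image_sub_le_of_Ioo (C := 2 * C * r ^ (m + 1)) hr.1 hcont
    (fun x hx => ((hasDerivAt_circleAverage_conj_mul hu hx.1 (hx.2.trans hr.2)).sub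
      ((hasDerivAt_ofReal_pow 2 x).const_mul a)).sub
        ((hasDerivAt_ofReal_pow 4 x).const_mul (b / 2))) fun x hx => ?_
  · simp only [Real.circleAverage_zero, Complex.ofReal_zero] at key
    convert! key using 1
    · congr 1; simp
    · ring
  · have h1 := h x ⟨hx.1, hx.2.trans hr.2⟩
    have e : 2 * (x : ℂ) * circleAverage (dz u) c x - a * ((2 : ℕ) * (x : ℂ) ^ (2 - 1))
          - b / 2 * ((4 : ℕ) * (x : ℂ) ^ (4 - 1)) =
        2 * (x : ℂ) * (circleAverage (dz u) c x - a - b * x ^ 2) := by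
      push_cast
      ring
    rw [e, norm_mul, norm_mul, Complex.norm_real, Real.norm_of_nonneg hx.1.le]
    have hx0 := hx.1.le
    calc _ ≤ ‖(2 : ℂ)‖ * x * (C * x ^ m) := by gcongr
      _ = 2 * C * x ^ (m + 1) := by
          simp
          ring
      _ ≤ _ := by
          gcongr
          exact hx.2.le

theorem norm_circleAverage_conj_mul_le {u : ℂ → ℂ} {c : ℂ} {R S : ℝ}
    (hS : ∀ z ∈ ball c R, ‖u z‖ ≤ S) {r : ℝ} (hr : r ∈ Ioo 0 R) :
    ‖circleAverage (fun z => (starRingEnd ℂ) (z - c) * u z) c r‖ ≤ S * r := by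
  refine norm_circleAverage_le fun z hz => ?_
  rw [abs_of_pos hr.1] at hz
  have h1 := hS z (sphere_subset_ball hr.2 hz)
  rw [norm_mul, RCLike.norm_conj, ← dist_eq_norm, mem_sphere.1 hz, mul_comm]
  exact mul_le_mul_of_nonneg_right h1 hr.1.le

/-- Interior estimate for `∂f/∂z` at the centre of a disk, in terms of bounds for `f` and its
bilaplacian. -/
theorem norm_dz_center_le {f : ℂ → ℂ} {c : ℂ} {R S G s : ℝ} (hf : ContDiffOn ℝ 4 f (ball c R))
    (hS : ∀ z ∈ ball c R, ‖f z‖ ≤ S)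
    (hG : ∀ z ∈ ball c R, ‖dzbar (dz (dzbar (dz f))) z‖ ≤ G) (hs : 0 < s) (hsR : 2 * s < R) :
    ‖dz f c‖ ≤ 3 / 2 * S / s + 64 * G * s ^ 3 := by
  have h3 : ContDiffOn ℝ 3 (dz f) (ball c R) := hf.dz isOpen_ball (by norm_num)
  have h2 : ContDiffOn ℝ 2 (dzbar (dz f)) (ball c R) := h3.dzbar isOpen_ball (by norm_num)
  have h1 : ContDiffOn ℝ 1 (dz (dzbar (dz f))) (ball c R) := h2.dz isOpen_ball (by norm_num)
  have hG0 : 0 ≤ G := (norm_nonneg _).trans (hG c (mem_ball_self (by linarith)))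
  set b := dz (dzbar (dz f)) c
  -- From `e3` to `e0` the remainders are `2Gr`, `4Gr³`, `8Gr³` and `16Gr⁵`.
  have e3 := norm_circleAverage_sub_le_of_dzbar (b := 0) (m := 0) h1 hG0 fun r hr => by
    simpa using norm_circleAverage_conj_mul_le hG hr
  have e2 := norm_circleAverage_conj_mul_sub_le_of_dz (b := 0) (m := 1) (h2.of_le (by norm_num))
    (by positivity) e3
  have e1 := norm_circleAverage_sub_le_of_dzbar (b := b) (m := 2) (C := 4 * G)
    (h3.of_le (by norm_num)) (by positivity) fun r hr => by
      refine le_of_eq_of_le ?_ ((e2 r hr).trans_eq ?_)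
      · simp [b]
      · ring
  have e0 := norm_circleAverage_conj_mul_sub_le_of_dz (m := 3) (hf.of_le (by norm_num))
    (by positivity) e1
  have key : ∀ r ∈ Ioo 0 R, ‖dz f c * r ^ 2 + b / 2 * r ^ 4‖ ≤ S * r + 16 * G * r ^ 5 := by
    intro r hr
    have := norm_sub_le (circleAverage (fun z => (starRingEnd ℂ) (z - c) * f z) c r)
      (circleAverage (fun z => (starRingEnd ℂ) (z - c) * f z) c r
      - dz f c * r ^ 2 - b / 2 * r ^ 4)
    have h4 := e0 r hr
    have h5 := norm_circleAverage_conj_mul_le hS hr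
    rw [show ∀ x y z : ℂ, x - (x - y - z) = y + z by intros; ring] at this
    rw [show 2 * (2 * (4 * G)) * r ^ (3 + 2) = 16 * G * r ^ 5 by ring] at h4
    linarith
  have k1 := key s ⟨hs, by linarith⟩
  have k2 := key (2 * s) ⟨by linarith, hsR⟩
  -- Sixteen times the relation at `s` minus the one at `2 * s` cancels the quartic term and leaves
  -- `16 - 4 = 12` times the quadratic one.
  have e : (12 * s ^ 2 : ℂ) * dz f c = 16 * (dz f c * s ^ 2 + b / 2 * s ^ 4) -
      (dz f c * (2 * s : ℝ) ^ 2 + b / 2 * (2 * s : ℝ) ^ 4) := by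
    push_cast
    ring
  have k3 : 12 * s ^ 2 * ‖dz f c‖ ≤ 16 * (S * s + 16 * G * s ^ 5) +
      (S * (2 * s) + 16 * G * (2 * s) ^ 5) := by
    calc 12 * s ^ 2 * ‖dz f c‖ = ‖(12 * s ^ 2 : ℂ) * dz f c‖ := by
          simp
      _ ≤ _ := by
          rw [e]
          refine (norm_sub_le _ _).trans (add_le_add ?_ k2)
          rw [norm_mul]
          simpa using k1
  have : 12 * s ^ 2 * ‖dz f c‖ ≤ 12 * s ^ 2 * (3 / 2 * S / s + 64 * G * s ^ 3) := by
    refine k3.trans_eq ?_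
    field_simp
    ring
  exact le_of_mul_le_mul_left this (by positivity)

/-! ### Linear decay at the circle. -/

theorem norm_center_le_of_dzbar_le {F : ℂ → ℂ} {K : ℝ} (hF : ContDiffOn ℝ 1 F (ball 0 1))
    (hFc : ContinuousOn F (closedBall 0 1)) (hF0 : ∀ z ∈ sphere (0 : ℂ) 1, F z = 0)
    (hK : ∀ z ∈ ball (0 : ℂ) 1, ‖dzbar F z‖ ≤ K) : ‖F 0‖ ≤ 2 * K := by
  -- The circle average goes from `F 0` at radius `0` to `0` at radius `1`, with derivative at most
  -- `2 * K`.
  have hcont : ContinuousOn (circleAverage F 0) (Icc 0 1) :=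
    Real.ContinuousOn.circleAverage (hFc.mono fun z hz => by simpa using hz.2) fun x hx => hx.1
  have key := norm_image_sub_le_of_Ioo (C := 2 * K) one_pos hcont
    (fun x hx => (circleAverage_dz_dzbar hF hx.1 hx.2).1) fun x hx => ?_
  · have h1 : circleAverage F 0 1 = 0 :=
      Real.circleAverage_const_on_circle fun z hz => hF0 z (by simpa using hz)
    simpa [h1] using key
  · have h := norm_circleAverage_conj_mul_le hK hx
    simp only [mul_comm ((starRingEnd ℂ) _)] at h
    rw [norm_mul, norm_div, Complex.norm_real, Real.norm_of_nonneg hx.1.le]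
    calc _ ≤ ‖(2 : ℂ)‖ / x * (K * x) := by
          gcongr
          exact div_nonneg (norm_nonneg _) hx.1.le
      _ = 2 * K := by
          have := hx.1.ne'
          simp
          field_simp

theorem continuous_indicator_ball {f : ℂ → ℂ} (hf : ContinuousOn f (ball 0 1))
    (h0 : HasBoundaryValues f fun _ => 0) : Continuous ((ball (0 : ℂ) 1).indicator f) := by
  rw [continuous_iff_continuousAt]
  intro x
  rcases lt_trichotomy ‖x‖ 1 with hx | hx | hx
  · have hxb : ball (0 : ℂ) 1 ∈ 𝓝 x := isOpen_ball.mem_nhds (by simpa using hx)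
    refine (hf.continuousAt hxb).congr ?_
    filter_upwards [hxb] with z hz using (indicator_of_mem hz f).symm
  · have hxb : x ∉ ball (0 : ℂ) 1 := by simp [hx]
    rw [ContinuousAt, indicator_of_notMem hxb]
    have h1 := h0 x (by simpa using hx)
    intro U hU
    have h2 := eventually_nhdsWithin_iff.1 (h1 hU)
    change ∀ᶠ z in 𝓝 x, z ∈ (ball (0 : ℂ) 1).indicator f ⁻¹' U
    filter_upwards [h2] with z hz
    by_cases hzb : z ∈ ball (0 : ℂ) 1
    · rw [mem_preimage, indicator_of_mem hzb]
      exact hz hzb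
    · rw [mem_preimage, indicator_of_notMem hzb]
      exact mem_of_mem_nhds hU
  · have hxb : (closedBall (0 : ℂ) 1)ᶜ ∈ 𝓝 x :=
      isClosed_closedBall.isOpen_compl.mem_nhds (by simpa using hx)
    refine (continuousAt_const (y := (0 : ℂ))).congr ?_
    filter_upwards [hxb] with z hz
    exact (indicator_of_notMem (fun h => hz (ball_subset_closedBall h)) f).symm

/-- The sign of the right-hand side shows that `z ↦ (z + a) / (1 + conj a * z)` preserves the disk
and the circle. -/
theorem sq_norm_one_add_conj_mul_sub (a z : ℂ) :
    ‖1 + (starRingEnd ℂ) a * z‖ ^ 2 - ‖z + a‖ ^ 2 = (1 - ‖a‖ ^ 2) * (1 - ‖z‖ ^ 2) := by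
  simp only [← Complex.normSq_eq_norm_sq, Complex.normSq_apply]
  simp
  ring

theorem one_add_conj_mul_ne_zero {a z : ℂ} (ha : ‖a‖ < 1) (hz : ‖z‖ ≤ 1) :
    1 + (starRingEnd ℂ) a * z ≠ 0 := by
  intro h
  have h1 : ‖(starRingEnd ℂ) a * z‖ = 1 := by
    rw [eq_neg_of_add_eq_zero_right h]
    simp
  rw [norm_mul, RCLike.norm_conj] at h1
  nlinarith [norm_nonneg a, norm_nonneg z]

/-- A function on the disk vanishing on the circle and with bounded `∂f/∂z̄` decays linearly at
the circle. -/
theorem norm_le_of_dzbar_le {f : ℂ → ℂ} {W : ℝ} (hf : ContDiffOn ℝ 1 f (ball 0 1))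
    (h0 : HasBoundaryValues f fun _ => 0) (hW : ∀ z ∈ ball (0 : ℂ) 1, ‖dzbar f z‖ ≤ W)
    {a : ℂ} (ha : a ∈ ball (0 : ℂ) 1) : ‖f a‖ ≤ 2 * W * (1 - ‖a‖ ^ 2) := by
  have ha' : ‖a‖ < 1 := by simpa using ha
  have ha2 : 0 < 1 - ‖a‖ ^ 2 := by nlinarith [norm_nonneg a]
  set d : ℂ → ℂ := fun z => 1 + (starRingEnd ℂ) a * z with hd
  set τ : ℂ → ℂ := fun z => (z + a) / d z with hτ
  -- Here `τ 0 = a`, so `F 0 = f a`. Since `τ' = (1 - ‖a‖ ^ 2) / d ^ 2`, the factor `d ^ 2` turns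
  -- the chain-rule factor into one of constant modulus `1 - ‖a‖ ^ 2`. Extension by zero makes `F`
  -- continuous up to the circle.
  set F : ℂ → ℂ := fun z => (ball (0 : ℂ) 1).indicator f (τ z) * d z ^ 2 with hF
  have hd0 : ∀ z ∈ closedBall (0 : ℂ) 1, d z ≠ 0 := fun z hz =>
    one_add_conj_mul_ne_zero ha' (by simpa using hz)
  have hdc : Continuous d := by fun_prop
  have hτc : ContinuousOn τ (closedBall 0 1) :=
    (by fun_prop : Continuous fun z => z + a).continuousOn.div hdc.continuousOn hd0
  have hτb : ∀ z ∈ ball (0 : ℂ) 1, τ z ∈ ball (0 : ℂ) 1 := by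
    intro z hz
    have hz' : ‖z‖ < 1 := by simpa using hz
    have h1 := sq_norm_one_add_conj_mul_sub a z
    have h2 : 0 < (1 - ‖a‖ ^ 2) * (1 - ‖z‖ ^ 2) :=
      mul_pos ha2 (by nlinarith [norm_nonneg z])
    have h3 : 0 < ‖d z‖ := norm_pos_iff.2 (hd0 z (ball_subset_closedBall hz))
    rw [mem_ball_zero_iff, norm_div, div_lt_one h3]
    exact lt_of_pow_lt_pow_left₀ 2 h3.le (by linarith)
  have hτs : ∀ z ∈ sphere (0 : ℂ) 1, τ z ∉ ball (0 : ℂ) 1 := by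
    intro z hz
    have hz' : ‖z‖ = 1 := by simpa using hz
    have h1 := sq_norm_one_add_conj_mul_sub a z
    have h3 : 0 < ‖d z‖ := norm_pos_iff.2 (hd0 z (sphere_subset_closedBall hz))
    rw [hz'] at h1
    have h4 : ‖d z‖ = ‖z + a‖ :=
      (pow_left_inj₀ h3.le (norm_nonneg _) two_ne_zero).1 (by linarith)
    rw [mem_ball_zero_iff, norm_div, h4, div_self (h4 ▸ h3.ne')]
    exact lt_irrefl _
  have hdd (z : ℂ) : HasDerivAt d ((starRingEnd ℂ) a) z := by
    simpa only [mul_one] using! ((hasDerivAt_id z).const_mul ((starRingEnd ℂ) a)).const_add 1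
  have hFeq : ∀ z ∈ ball (0 : ℂ) 1, F z = f (τ z) * d z ^ 2 := fun z hz => by
    simp only [hF]
    rw [indicator_of_mem (hτb z hz)]
  have hdsm : ContDiff ℝ 1 d := by fun_prop
  have hτsm : ContDiffOn ℝ 1 τ (ball 0 1) := by
    simp only [hτ, div_eq_mul_inv]
    exact (by fun_prop : ContDiff ℝ 1 fun z : ℂ => z + a).contDiffOn.mul
      (hdsm.contDiffOn.inv fun z hz => hd0 z (ball_subset_closedBall hz))
  have key := norm_center_le_of_dzbar_le (F := F) (K := W * (1 - ‖a‖ ^ 2))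
    (((hf.comp hτsm hτb).mul (hdsm.pow 2).contDiffOn).congr hFeq)
    (((continuous_indicator_ball hf.continuousOn h0).comp_continuousOn hτc).mul
      (hdc.pow 2).continuousOn)
    (fun z hz => by simp only [hF]; rw [indicator_of_notMem (hτs z hz), zero_mul]) ?_
  · have e : F 0 = f a := by
      rw [hFeq 0 (by simp)]
      simp [hτ, hd]
    rw [e] at key
    linarith
  · intro z hz
    have hdz := hd0 z (ball_subset_closedBall hz)
    have hτd : HasDerivAt τ (((1 - ‖a‖ ^ 2 : ℝ) : ℂ) / d z ^ 2) z := by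
      convert! ((hasDerivAt_id z).add_const a).div (hdd z) hdz using 2
      simp only [hd, id]
      push_cast
      rw [← Complex.mul_conj']
      ring
    have hfd : HasFDerivAt f (fderiv ℝ f (τ z)) (τ z) :=
      ((hf.contDiffAt (isOpen_ball.mem_nhds (hτb z hz))).differentiableAt
        (by norm_num)).hasFDerivAt
    have h1 := (hfd.comp z (hτd.hasFDerivAt.restrictScalars ℝ)).mul
      (((hdd z).pow 2).hasFDerivAt.restrictScalars ℝ)
    have h2 : HasFDerivAt F _ z := h1.congr_of_eventuallyEq (by
      filter_upwards [isOpen_ball.mem_nhds hz] with w hw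
      exact hFeq w hw)
    -- As `τ` and `d` are holomorphic, only `dzbar f` contributes to the conjugate-linear part `β`.
    have h3 := h2.dzbar_eq
      (α := f (τ z) * (2 * d z * (starRingEnd ℂ) a) + d z ^ 2 * (dz f (τ z) *
        (((1 - ‖a‖ ^ 2 : ℝ) : ℂ) / d z ^ 2)))
      (β := d z ^ 2 * (dzbar f (τ z) * (starRingEnd ℂ) (((1 - ‖a‖ ^ 2 : ℝ) : ℂ) / d z ^ 2)))
      fun v => by
        simp only [add_apply, smul_apply,
          ContinuousLinearMap.comp_apply, fderiv_apply_eq]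
        simp
        ring
    have h4 : 0 < ‖d z‖ := norm_pos_iff.2 hdz
    rw [h3, norm_mul, norm_mul, RCLike.norm_conj, norm_div, norm_pow, Complex.norm_real,
      Real.norm_of_nonneg ha2.le]
    calc _ = ‖dzbar f (τ z)‖ * (1 - ‖a‖ ^ 2) := by field_simp
      _ ≤ _ := mul_le_mul_of_nonneg_right (hW _ (hτb z hz)) ha2.le

/-! ### Global bounds and conclusion. -/

theorem HasBoundaryValues.exists_norm_le {u φ : ℂ → ℂ} (hu : ContinuousOn u (ball 0 1))
    (h : HasBoundaryValues u φ) : ∃ C, ∀ z ∈ ball (0 : ℂ) 1, ‖u z‖ ≤ C := by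
  -- Local boundedness near each point of the compact closed disk, boundary included, is patched by
  -- compactness.
  have key : ∃ C, ∀ z ∈ closedBall (0 : ℂ) 1 ∩ ball (0 : ℂ) 1, ‖u z‖ ≤ C := by
    refine (isCompact_closedBall (0 : ℂ) 1).induction_on
      (p := fun s => ∃ C, ∀ z ∈ s ∩ ball (0 : ℂ) 1, ‖u z‖ ≤ C) ⟨0, by simp⟩
      (fun s t hst ⟨C, hC⟩ => ⟨C, fun z hz => hC z ⟨hst hz.1, hz.2⟩⟩)
      (fun s t ⟨C, hC⟩ ⟨D, hD⟩ => ⟨max C D, fun z hz => ?_⟩) fun x hx => ?_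
    · rcases hz.1 with h1 | h1
      · exact (hC z ⟨h1, hz.2⟩).trans (le_max_left _ _)
      · exact (hD z ⟨h1, hz.2⟩).trans (le_max_right _ _)
    · obtain ⟨y, hy⟩ : ∃ y, Tendsto u (𝓝[ball (0 : ℂ) 1] x) (𝓝 y) := by
        rcases (mem_closedBall_zero_iff.1 hx).lt_or_eq with h1 | h1
        · exact ⟨_, hu x (by simpa using h1)⟩
        · exact ⟨_, h x (by simpa using h1)⟩
      have h2 := eventually_nhdsWithin_iff.1
        (hy.norm.eventually_le_const (lt_add_one ‖y‖))
      exact ⟨_, mem_nhdsWithin_of_mem_nhds h2, ‖y‖ + 1, fun z hz => hz.1 hz.2⟩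
  exact key.imp fun C hC z hz => hC z ⟨ball_subset_closedBall hz, hz⟩

theorem laplacian_laplacian_eq {f : ℂ → ℂ} {s : Set ℂ} (hf : ContDiffOn ℝ 4 f s) (hs : IsOpen s)
    {z : ℂ} (hz : z ∈ s) :
    Laplacian.laplacian (Laplacian.laplacian f) z = 16 * dzbar (dz (dzbar (dz f))) z := by
  have h3 : ContDiffOn ℝ 3 (dz f) s := hf.dz hs (by norm_num)
  have h2 : ContDiffOn ℝ 2 (dzbar (dz f)) s := h3.dzbar hs (by norm_num)
  have e : Laplacian.laplacian f =ᶠ[𝓝 z] (4 : ℂ) • dzbar (dz f) := by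
    filter_upwards [hs.mem_nhds hz] with w hw
    rw [Pi.smul_apply, dzbar_dz_eq (hf.of_le (by norm_num)) hs hw, smul_eq_mul]
    ring
  rw [(InnerProductSpace.laplacian_congr_nhds e).eq_of_nhds,
    InnerProductSpace.laplacian_smul _ (h2.contDiffAt (hs.mem_nhds hz)), dzbar_dz_eq h2 hs hz,
    smul_eq_mul]
  ring

/-- The disk has diameter `2`, and `ω t ≥ (ω 2 / 2) * t` for `0 < t ≤ 2`. Taking `|L| + 1` keeps the
constant positive. -/
theorem IsMajorant.memLipschitzSpace_ball {ω : ℝ → ℝ} (hω : IsMajorant ω) {f : ℂ → ℂ} {L : ℝ}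
    (hL : ∀ z₁ ∈ ball (0 : ℂ) 1, ∀ z₂ ∈ ball (0 : ℂ) 1, ‖f z₁ - f z₂‖ ≤ L * ‖z₁ - z₂‖) :
    MemLipschitzSpace ω (ball (0 : ℂ) 1) f := by
  have hω2 := hω.pos 2 two_pos
  refine ⟨(|L| + 1) * (2 / ω 2), by positivity, fun z₁ h₁ z₂ h₂ => ?_⟩
  rcases (norm_nonneg (z₁ - z₂)).eq_or_lt with h | h
  · rw [← h, hω.map_zero, mul_zero]
    exact (hL z₁ h₁ z₂ h₂).trans_eq (by rw [← h, mul_zero])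
  · have ht : ‖z₁ - z₂‖ ≤ 2 := by
      have h3 := norm_sub_le z₁ z₂
      have h4 := mem_ball_zero_iff.1 h₁
      have h5 := mem_ball_zero_iff.1 h₂
      linarith
    have h6 : ω 2 / 2 ≤ ω ‖z₁ - z₂‖ / ‖z₁ - z₂‖ :=
      hω.antitoneOn_div h (mem_Ioi.2 two_pos) ht
    rw [le_div_iff₀ h] at h6
    calc ‖f z₁ - f z₂‖ ≤ L * ‖z₁ - z₂‖ := hL z₁ h₁ z₂ h₂
      _ ≤ (|L| + 1) * ‖z₁ - z₂‖ := by
          gcongr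
          linarith [le_abs_self L]
      _ = (|L| + 1) * (2 / ω 2) * (ω 2 / 2 * ‖z₁ - z₂‖) := by field_simp
      _ ≤ _ := by gcongr

theorem corollary1 (ω : ℝ → ℝ) (hω : IsMajorant ω)
    (g : ℂ → ℂ) (hg : ContinuousOn g (closedBall (0 : ℂ) 1))
    (φ : ℂ → ℂ) (hφ : MemLipschitzSpace ω (sphere (0 : ℂ) 1) φ)
    (f : ℂ → ℂ) (hf : ContDiffOn ℝ 4 f (ball (0 : ℂ) 1))
    (hfg : ∀ z ∈ ball (0 : ℂ) 1,
      Laplacian.laplacian (Laplacian.laplacian f) z = g z)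
    (hfφ : HasBoundaryValues (dzbar f) φ)
    (hf0 : HasBoundaryValues f (fun _ => 0)) :
    MemLipschitzSpace ω (ball (0 : ℂ) 1) f := by
  obtain ⟨W, hW⟩ := hfφ.exists_norm_le
    (hf.dzbar (m := 0) isOpen_ball (by norm_num)).continuousOn
  obtain ⟨G, hG⟩ := (isCompact_closedBall (0 : ℂ) 1).exists_bound_of_continuousOn hg
  have hW0 : 0 ≤ W := (norm_nonneg _).trans (hW 0 (by simp))
  have hG0 : 0 ≤ G := (norm_nonneg _).trans (hG 0 (by simp))
  have hfb {z : ℂ} (hz : z ∈ ball (0 : ℂ) 1) : ‖f z‖ ≤ 2 * W * (1 - ‖z‖ ^ 2) :=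
    norm_le_of_dzbar_le (hf.of_le (by norm_num)) hf0 hW hz
  -- Of the bound, `48 * W + 4 * G` comes from `dz f` and the remaining `W` from `dzbar f`.
  have hgrad : ∀ z ∈ ball (0 : ℂ) 1, ‖fderiv ℝ f z‖ ≤ 49 * W + 4 * G := by
    intro c hc
    have hc' : ‖c‖ < 1 := by simpa using hc
    have hsub : ball c (1 - ‖c‖) ⊆ ball 0 1 := ball_subset_ball' (by simp)
    -- The interior estimate is used on the disk of radius `1 - ‖c‖` with `s` a quarter of it. There
    -- `1 - ‖z‖ ^ 2 ≤ 4 * (1 - ‖c‖)`, whence `8 * W * (1 - ‖c‖)`; `G / 16` reflects `Δ = 4 ∂_z̄ ∂_z`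
    -- applied twice.
    have h1 : ‖dz f c‖ ≤ 3 / 2 * (8 * W * (1 - ‖c‖)) / ((1 - ‖c‖) / 4)
        + 64 * (G / 16) * ((1 - ‖c‖) / 4) ^ 3 := by
      refine norm_dz_center_le (hf.mono hsub) (fun z hz => ?_) (fun z hz => ?_) (by linarith)
        (by linarith)
      · refine (hfb (hsub hz)).trans ?_
        have h2 : ‖z‖ < 1 := by simpa using hsub hz
        have h3 : ‖z - c‖ < 1 - ‖c‖ := by simpa [dist_eq_norm] using hz
        have h4 := norm_sub_norm_le c z
        rw [norm_sub_rev] at h4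
        have h5 : 1 - ‖z‖ ^ 2 ≤ 4 * (1 - ‖c‖) := by nlinarith [norm_nonneg z]
        nlinarith
      · have h2 := laplacian_laplacian_eq hf isOpen_ball (hsub hz)
        have h3 := hG z (ball_subset_closedBall (hsub hz))
        rw [← hfg z (hsub hz), h2, norm_mul] at h3
        norm_num at h3
        linarith
    have h2 : 3 / 2 * (8 * W * (1 - ‖c‖)) / ((1 - ‖c‖) / 4) = 48 * W := by
      have : 1 - ‖c‖ ≠ 0 := by linarith
      field_simp
      ring
    have h3 : ((1 - ‖c‖) / 4) ^ 3 ≤ 1 :=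
      pow_le_one₀ (by linarith) (by linarith [norm_nonneg c])
    have h4 := norm_fderiv_le f c
    have h5 := hW c hc
    nlinarith
  refine hω.memLipschitzSpace_ball (L := 49 * W + 4 * G) fun z₁ h₁ z₂ h₂ => ?_
  exact (convex_ball (0 : ℂ) 1).norm_image_sub_le_of_norm_fderiv_le
    (fun z hz => (hf.contDiffAt (isOpen_ball.mem_nhds hz)).differentiableAt (by norm_num))
    hgrad h₂ h₁
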